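/- Let $V=[n]$ and let $\widehat{\mathbb S}^n$ be the space of real symmetric matrices with rows and columns indexed by $\{0\}\cup V$, with the trace inner product $\langle X,Y\rangle=\operatorname{tr}(XY^{\top})$; write $X\succeq 0$ for positive semidefinite. Let $\mathcal A:\widehat{\mathbb S}^n\to\mathbb R^m$ and $\mathcal L:\mathbb R^k\to\widehat{\mathbb S}^n$ be linear maps with adjoints $\mathcal A^*,\mathcal L^*$, and let $b\in\mathbb R^m$. For $U\subseteq V$ let $1_U\in\{0,1\}^V$ be its incidence vector. For $\hat C\in\widehat{\mathbb S}^n$ consider the four problems - (ISDP) $\sup\{\langle \hat C,X\rangle : \mathcal A(X)\le b,\ X=\sum_{U\subseteq V}m_U\binom{1}{1_U}\binom{1}{1_U}^{\top}\text{ for some } m:2^V\to\mathbb Z_{+}\}$; - (SDP) $\sup\{\langle \hat C,X\rangle : \mathcal A(X)\le b,\ X\succeq 0\}$; - (SDD) $\inf\{b^{\top}y : y\in\mathbb R^m_{+},\ \mathcal A^*(y)-\hat C\succeq 0\}$; - (ISDD) $\inf\{b^{\top}y : y\in\mathbb Z^m_{+},\ \mathcal A^*(y)-\hat C=\sum_{U\subseteq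 V}m_U\binom{-1}{1_U}\binom{-1}{1_U}^{\top}\text{ for some } m:2^V\to\mathbb Z_{+}\}$. Their values satisfy (ISDP) $\le$ (SDP) $\le$ (SDD) $\le$ (ISDD). The system $\mathcal A(X)\le b$, $X\succeq 0$ is *totally dual integral through $\mathcal L$* if, for every $c\in\mathbb Z^k$, whenever (SDD) with $\hat C=\mathcal L(c)$ has an optimal solution, it has an optimal solution that is feasible in (ISDD). **Theorem.** Suppose that the system $\mathcal A(X)\le b$, $X\succeq 0$ is totally dual integral through $\mathcal L$ and that $b$ is integral. Let $\hat{\mathscr C}=\{X\succeq 0:\mathcal A(X)\le b\}$ and $\mathscr C=\mathcal L^*(\hat{\mathscr C})\subseteq\mathbb R^k$, and suppose that $\hat{\mathscr C}$ contains a positive definite matrix, that $\mathscr C\subseteq[0,1]^k$, and that $\mathscr C$ is compact. Let $\mathscr C_I=\operatorname{conv}(\mathscr C\cap\mathbb Z^k)$, and suppose that $\hat{\mathscr C}$ is a rank-one embedding of $\mathscr C_I$ via $\mathcal L$, that is, for every $\bar x\in\mathscr C\cap\{0,1\}^k$ there is $U\subseteq V$ such that $X=\binom{1}{1_U}\binom{1}{1_U}^{\top}$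 lies in $\hat{\mathscr C}$ and $\mathcal L^*(X)=\bar x$. Then for every $w\in\mathbb Z^k$ the optimal values of (ISDP), (SDP), (SDD) and (ISDD) with $\hat C=\mathcal L(w)$ are all equal to $\max\{w^{\top}x : x\in\mathscr C_I\}$, and all these suprema and infima, including this maximum, are attained. -/

import Mathlib

namespace SemidefTDI

/-- The real vector space of symmetric `W × W` matrices, as a subspace of all matrices. -/
def symSubmodule (W : Type*) : Submodule ℝ (Matrix W W ℝ) where
  carrier := {X | X.IsSymm}
  add_mem' hX hY := hX.add hY
  zero_mem' := Matrix.isSymm_zero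
  smul_mem' c _ hX := hX.smul c

/-- The space of symmetric real `W × W` matrices. It is kept separate from the subtype, so that
the only inner product and norm on it are those of the trace inner product below. -/
def SymMat (W : Type*) : Type _ := symSubmodule W

instance (W : Type*) : AddCommGroup (SymMat W) := inferInstanceAs (AddCommGroup (symSubmodule W))

noncomputable instance (W : Type*) : Module ℝ (SymMat W) :=
  inferInstanceAs (Module ℝ (symSubmodule W))

instance (W : Type*) [Fintype W] : FiniteDimensional ℝ (SymMat W) :=
  inferInstanceAs (FiniteDimensional ℝ (symSubmodule W))

/-- The underlying matrix. -/
def SymMat.toMatrix {W : Type*} : SymMat W →ₗ[ℝ] Matrix W W ℝ := (symSubmodule W).subtype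

/-- The trace inner product `⟨X, Y⟩ = tr (X Yᵀ)`. -/
noncomputable instance SymMat.core (W : Type*) [Fintype W] :
    InnerProductSpace.Core ℝ (SymMat W) where
  inner X Y := (X.toMatrix * Y.toMatrix.transpose).trace
  conj_inner_symm X Y := by
    rw [conj_trivial, ← Matrix.trace_transpose, Matrix.transpose_mul, Matrix.transpose_transpose]
  re_inner_nonneg X := by
    simp only [Matrix.trace, Matrix.diag, Matrix.mul_apply, Matrix.transpose_apply]
    exact Finset.sum_nonneg fun i _ => Finset.sum_nonneg fun j _ => mul_self_nonneg _
  add_left X Y Z := by simp [Matrix.add_mul]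
  smul_left X Y r := by simp
  definite X h := by
    simp only [Matrix.trace, Matrix.diag, Matrix.mul_apply, Matrix.transpose_apply] at h
    apply Subtype.ext
    ext i j
    have h1 := (Finset.sum_eq_zero_iff_of_nonneg
      (fun i _ => Finset.sum_nonneg fun j _ => mul_self_nonneg _)).1 h i (Finset.mem_univ _)
    have h2 := (Finset.sum_eq_zero_iff_of_nonneg
      (fun j _ => mul_self_nonneg _)).1 h1 j (Finset.mem_univ _)
    exact mul_self_eq_zero.1 h2

noncomputable instance (W : Type*) [Fintype W] : NormedAddCommGroup (SymMat W) :=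
  (SymMat.core W).toNormedAddCommGroup

noncomputable instance (W : Type*) [Fintype W] : InnerProductSpace ℝ (SymMat W) :=
  InnerProductSpace.ofCore (SymMat.core W).toCore

/-- The lifted matrix space: symmetric matrices indexed by `{0} ∪ V`. The extra index `0` is
`none`, and `j ∈ V` is `some j`. -/
abbrev SymHat (V : Type*) : Type _ := SymMat (Option V)

/-- The symmetric rank-one matrix `h hᵀ`. -/
def outer {W : Type*} (h : W → ℝ) : SymMat W :=
  ⟨Matrix.vecMulVec h h, by
    ext i j
    simp [Matrix.vecMulVec_apply, mul_comm]⟩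

/-- The vector `t ⊕ 1_U` indexed by `{0} ∪ V`, with `1_U` the incidence vector of `U`. -/
def liftVec {V : Type*} [DecidableEq V] (t : ℝ) (U : Finset V) : Option V → ℝ
  | none => t
  | some j => if j ∈ U then 1 else 0

section

variable {V : Type*} [Fintype V] [DecidableEq V] {m k : ℕ}

/-- The rank-one embedding of a subset `U ⊆ V`: the matrix `(1 ⊕ 1_U)(1 ⊕ 1_U)ᵀ`. -/
def embed (U : Finset V) : SymHat V := outer (liftVec 1 U)

/-- Primal integrality: `X` is a nonnegative integer combination of the matrices
`(1 ⊕ 1_U)(1 ⊕ 1_U)ᵀ`, `U ⊆ V`. -/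
def PrimalIntegral (X : SymHat V) : Prop :=
  ∃ μ : Finset V → ℕ, X = ∑ U : Finset V, (μ U : ℝ) • outer (liftVec 1 U)

/-- Dual integrality: `S` is a nonnegative integer combination of the matrices
`(-1 ⊕ 1_U)(-1 ⊕ 1_U)ᵀ`, `U ⊆ V`. -/
def DualIntegral (S : SymHat V) : Prop :=
  ∃ μ : Finset V → ℕ, S = ∑ U : Finset V, (μ U : ℝ) • outer (liftVec (-1) U)

/-- A real vector with integer coordinates. -/
def IntVec {d : ℕ} (x : EuclideanSpace ℝ (Fin d)) : Prop := ∀ i, ∃ z : ℤ, x i = z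

/-- The feasible region of (SDP): `{X ⪰ 0 : 𝒜(X) ≤ b}`. -/
def sdpFeasible (A : SymHat V →ₗ[ℝ] EuclideanSpace ℝ (Fin m)) (b : EuclideanSpace ℝ (Fin m)) :
    Set (SymHat V) :=
  {X | X.toMatrix.PosSemidef ∧ ∀ i, A X i ≤ b i}

/-- The feasible region of (ISDP). -/
def isdpFeasible (A : SymHat V →ₗ[ℝ] EuclideanSpace ℝ (Fin m)) (b : EuclideanSpace ℝ (Fin m)) :
    Set (SymHat V) :=
  {X | PrimalIntegral X ∧ ∀ i, A X i ≤ b i}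

/-- The feasible region of (SDD): `{y ≥ 0 : 𝒜*(y) - C ⪰ 0}`. -/
noncomputable def sddFeasible (A : SymHat V →ₗ[ℝ] EuclideanSpace ℝ (Fin m)) (C : SymHat V) :
    Set (EuclideanSpace ℝ (Fin m)) :=
  {y | (∀ i, 0 ≤ y i) ∧ (LinearMap.adjoint A y - C).toMatrix.PosSemidef}

/-- The feasible region of (ISDD). -/
noncomputable def isddFeasible (A : SymHat V →ₗ[ℝ] EuclideanSpace ℝ (Fin m)) (C : SymHat V) :
    Set (EuclideanSpace ℝ (Fin m)) :=
  {y | IntVec y ∧ (∀ i, 0 ≤ y i) ∧ DualIntegral (LinearMap.adjoint A y - C)}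

/-- The supremum over `F` of the linear objective `x ↦ ⟨c, x⟩`, in `[-∞, +∞]`. -/
noncomputable def supValue {E : Type*} [NormedAddCommGroup E] [InnerProductSpace ℝ E]
    (c : E) (F : Set E) : EReal :=
  ⨆ x ∈ F, ((inner ℝ c x : ℝ) : EReal)

/-- The infimum over `F` of the linear objective `x ↦ ⟨c, x⟩`, in `[-∞, +∞]`. -/
noncomputable def infValue {E : Type*} [NormedAddCommGroup E] [InnerProductSpace ℝ E]
    (c : E) (F : Set E) : EReal :=
  ⨅ x ∈ F, ((inner ℝ c x : ℝ) : EReal)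

/-- `y` is an optimal solution of the dual problem (SDD). -/
def IsSddOptimal (A : SymHat V →ₗ[ℝ] EuclideanSpace ℝ (Fin m)) (b : EuclideanSpace ℝ (Fin m))
    (C : SymHat V) (y : EuclideanSpace ℝ (Fin m)) : Prop :=
  y ∈ sddFeasible A C ∧ ∀ z ∈ sddFeasible A C, inner ℝ b y ≤ inner ℝ b z

/-- The system `𝒜(X) ≤ b`, `X ⪰ 0` is totally dual integral through `L`: for every integral `c`,
the dual of `sup {⟨L(c), X⟩ : 𝒜(X) ≤ b, X ⪰ 0}` has an integral optimal solution whenever it has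
an optimal solution. -/
def IsTDIThrough (A : SymHat V →ₗ[ℝ] EuclideanSpace ℝ (Fin m)) (b : EuclideanSpace ℝ (Fin m))
    (L : EuclideanSpace ℝ (Fin k) →ₗ[ℝ] SymHat V) : Prop :=
  ∀ c : EuclideanSpace ℝ (Fin k), IntVec c →
    (∃ y, IsSddOptimal A b (L c) y) →
      ∃ y, IsSddOptimal A b (L c) y ∧ y ∈ isddFeasible A (L c)

/-- The integer hull `C_I = conv (C ∩ ℤᵏ)`. -/
def integerHull (C : Set (EuclideanSpace ℝ (Fin k))) : Set (EuclideanSpace ℝ (Fin k)) :=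
  convexHull ℝ (C ∩ {x | IntVec x})

/-- `Chat` is a rank-one embedding of `C_I` via `L` (for `C ⊆ [0,1]ᵏ`): every 0-1 point of `C` is
the image under `L*` of some `(1 ⊕ 1_U)(1 ⊕ 1_U)ᵀ ∈ Chat`. -/
def IsRankOneEmbedding (L : EuclideanSpace ℝ (Fin k) →ₗ[ℝ] SymHat V) (Chat : Set (SymHat V))
    (C : Set (EuclideanSpace ℝ (Fin k))) : Prop :=
  ∀ x ∈ C, (∀ i, x i = 0 ∨ x i = 1) →
    ∃ U : Finset V, embed U ∈ Chat ∧ LinearMap.adjoint L (embed U) = x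

end

end SemidefTDI

open SemidefTDI

/-!
Slater's condition, with `𝒜(X) ≤ b` polyhedral and a positive definite feasible matrix, gives strong
duality with dual attainment: separate the positive definite cone from the polyhedral cone of
points that would violate the bound, and rewrite the separating functional by Farkas' lemma.
Total dual integrality then makes `max {⟨w, x⟩ : x ∈ 𝒞}` an integer for every integral `w`.

A compact set `S` whose support function is integral in integral directions contains an integral
point. Indeed, each face of `S` in an integral direction `w` again has this property, because
`h_S(N w + u) - N h_S(w)` is an integer converging to `h_F(u)` on the face `F`; passing to the faces
in the coordinate directions successively makes every coordinate an integer constant. Applied to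
the face of `𝒞` in direction `w`, this yields an integral, hence 0-1, maximizer, whose rank-one
embedding closes the chain (ISDP) ≤ (SDP) = (SDD) ≤ (ISDD).
-/

namespace SemidefTDI

open Filter Topology

section Farkas

variable {𝕜 E ι : Type*} [Field 𝕜] [LinearOrder 𝕜] [IsStrictOrderedRing 𝕜] [AddCommGroup E]
  [Module 𝕜 E]

theorem apply_nonpos_of_mem_hull {s : Set (E →ₗ[𝕜] 𝕜)} {x : E} (hs : ∀ f ∈ s, f x ≤ 0)
    {f : E →ₗ[𝕜] 𝕜} (hf : f ∈ PointedCone.hull 𝕜 s) : f x ≤ 0 := by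
  induction hf using Submodule.span_induction with
  | mem f hf => exact hs f hf
  | zero => simp
  | add f g _ _ hf hg => simpa using add_nonpos hf hg
  | smul r f _ hf => exact mul_nonpos_of_nonneg_of_nonpos r.2 hf

theorem exists_mem_hull_image_comp_eq {F : Type*} [AddCommGroup F] [Module 𝕜 F] (π : E →ₗ[𝕜] F)
    {s : Set ι} {a : ι → F →ₗ[𝕜] 𝕜} {g : E →ₗ[𝕜] 𝕜}
    (hg : g ∈ PointedCone.hull 𝕜 ((fun i => a i ∘ₗ π) '' s)) :
    ∃ f ∈ PointedCone.hull 𝕜 (a '' s), f ∘ₗ π = g := by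
  let comp_π := (LinearMap.lcomp 𝕜 𝕜 π).restrictScalars {r : 𝕜 // 0 ≤ r}
  have himage : (fun i => a i ∘ₗ π) '' s = comp_π '' (a '' s) := by
    rw [Set.image_image]
    rfl
  rwa [himage, PointedCone.hull, ← Submodule.map_span] at hg

/- Inductive step: if dropping the constraint `j` breaks the implication, then some `x` with
`a j x = 1` violates it, and the remaining constraints are composed with the projection along `x`
onto `ker (a j)`. -/
theorem mem_hull_image_of_forall_nonpos (s : Finset ι) (a : ι → E →ₗ[𝕜] 𝕜) (c : E →ₗ[𝕜] 𝕜)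
    (h : ∀ x, (∀ i ∈ s, a i x ≤ 0) → c x ≤ 0) : c ∈ PointedCone.hull 𝕜 (a '' s) := by
  classical
  induction s using Finset.induction_on generalizing a c with
  | empty =>
    obtain rfl : c = 0 := LinearMap.ext fun x =>
      le_antisymm (h x (by simp)) (by simpa using h (-x) (by simp))
    exact zero_mem _
  | insert j s _ ih =>
    rw [Finset.coe_insert, Set.image_insert_eq]
    by_cases hc : ∀ x, (∀ i ∈ s, a i x ≤ 0) → c x ≤ 0
    · exact Submodule.span_mono (Set.subset_insert _ _) (ih a c hc)
    obtain ⟨x, hxs, hxj, hcx⟩ : ∃ x, (∀ i ∈ s, a i x ≤ 0) ∧ a j x = 1 ∧ 0 < c x := by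
      push Not at hc
      obtain ⟨z, hzs, hcz⟩ := hc
      have hzj : 0 < a j z := by
        by_contra! hzj
        exact hcz.not_ge (h z (Finset.forall_mem_insert .. |>.2 ⟨hzj, hzs⟩))
      refine ⟨(a j z)⁻¹ • z, fun i hi => ?_, ?_, ?_⟩
      · simpa using mul_nonpos_of_nonneg_of_nonpos (inv_nonneg.2 hzj.le) (hzs i hi)
      · simp [hzj.ne']
      · simpa using mul_pos (inv_pos.2 hzj) hcz
    let π : E →ₗ[𝕜] E := LinearMap.id - (a j).smulRight x
    have apply_π (f : E →ₗ[𝕜] 𝕜) (z : E) : f (π z) = f z - a j z * f x := by simp [π]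
    obtain ⟨f, hf, hfc⟩ := exists_mem_hull_image_comp_eq π <|
      ih (fun i => a i ∘ₗ π) (c ∘ₗ π) fun z hz =>
        h (π z) (Finset.forall_mem_insert .. |>.2 ⟨by simp [apply_π, hxj], hz⟩)
    have hfx : f x ≤ 0 := apply_nonpos_of_mem_hull (by simpa using hxs) hf
    refine Submodule.mem_span_insert.2 ⟨⟨c x - f x, by linarith⟩, f, hf, LinearMap.ext fun z => ?_⟩
    have hfcz : f z - a j z * f x = c z - a j z * c x := by
      rw [← apply_π, ← apply_π]
      exact LinearMap.congr_fun hfc z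
    change c z = (c x - f x) * a j z + f z
    linear_combination -hfcz

theorem farkas [Fintype ι] (a : ι → E →ₗ[𝕜] 𝕜) (c : E →ₗ[𝕜] 𝕜)
    (h : ∀ x, (∀ i, a i x ≤ 0) → c x ≤ 0) :
    ∃ y : ι → 𝕜, (∀ i, 0 ≤ y i) ∧ ∀ x, c x = ∑ i, y i * a i x := by
  have hmem := mem_hull_image_of_forall_nonpos Finset.univ a c (by simpa using h)
  rw [Finset.coe_univ, Set.image_univ] at hmem
  obtain ⟨y, rfl⟩ := (Submodule.mem_span_range_iff_exists_fun _).1 hmem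
  exact ⟨fun i => y i, fun i => (y i).2, fun x => LinearMap.sum_apply _ _ _⟩

end Farkas

section ConicDuality

theorem nonneg_of_forall_pos_nonneg_add_mul {p q : ℝ} (h : ∀ t > 0, 0 ≤ p + t * q) : 0 ≤ p := by
  have hlim : Tendsto (fun t => p + t * q) (𝓝[>] 0) (𝓝 p) := by
    have hcont : Continuous fun t : ℝ => p + t * q := by fun_prop
    simpa using hcont.continuousWithinAt.tendsto (x := (0 : ℝ))
  exact ge_of_tendsto hlim (eventually_mem_nhdsWithin.mono h)

variable {E ι : Type*} [AddCommGroup E] [Module ℝ E]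

/-- The convex cone of points at which every `a i` is nonpositive and `c` is positive. For the
maximization of `c` subject to `a i ≤ 0`, these are the points violating the bound `c ≤ 0`. -/
def violatingCone (a : ι → E →ₗ[ℝ] ℝ) (c : E →ₗ[ℝ] ℝ) : ConvexCone ℝ E where
  carrier := {x | (∀ i, a i x ≤ 0) ∧ 0 < c x}
  smul_mem' t ht x hx := by
    refine ⟨fun i => ?_, ?_⟩
    · simpa using mul_nonpos_of_nonneg_of_nonpos ht.le (hx.1 i)
    · simpa using mul_pos ht hx.2
  add_mem' x hx z hz := by
    refine ⟨fun i => ?_, ?_⟩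
    · simpa using add_nonpos (hx.1 i) (hz.1 i)
    · simpa using add_pos hx.2 hz.2

theorem nonneg_of_nonneg_on_violatingCone {a : ι → E →ₗ[ℝ] ℝ} {c f : E →ₗ[ℝ] ℝ}
    (hne : (violatingCone a c : Set E).Nonempty) (hf : ∀ x ∈ violatingCone a c, 0 ≤ f x) {x : E}
    (hxa : ∀ i, a i x ≤ 0) (hxc : 0 ≤ c x) : 0 ≤ f x := by
  obtain ⟨z, hza, hzc⟩ := hne
  refine nonneg_of_forall_pos_nonneg_add_mul (q := f z) fun t ht => ?_
  have hmem : x + t • z ∈ violatingCone a c := by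
    refine ⟨fun i => ?_, ?_⟩
    · simpa using add_nonpos (hxa i) (mul_nonpos_of_nonneg_of_nonpos ht.le (hza i))
    · simpa using add_pos_of_nonneg_of_pos hxc (mul_pos ht hzc)
  simpa using hf _ hmem

variable [TopologicalSpace E] [IsTopologicalAddGroup E] [ContinuousSMul ℝ E]

theorem exists_neg_on_isOpen_nonneg_on_cone {K : Set E} (hKo : IsOpen K) (hKc : Convex ℝ K)
    {Q : ConvexCone ℝ E} (hQ : (Q : Set E).Nonempty) (hdisj : Disjoint K Q) :
    ∃ f : E →ₗ[ℝ] ℝ, (∀ x ∈ K, f x < 0) ∧ ∀ x ∈ Q, 0 ≤ f x := by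
  obtain ⟨f, α, hfK, hfQ⟩ := geometric_hahn_banach_open hKc hKo Q.convex hdisj
  have hαQ : ∀ x ∈ Q, ∀ t > 0, α ≤ t * f x := fun x hx t ht => by
    simpa using hfQ _ (Q.smul_mem ht hx)
  obtain ⟨z, hz⟩ := hQ
  have hα : α ≤ 0 := by
    refine neg_nonneg.1 (nonneg_of_forall_pos_nonneg_add_mul (q := f z) fun t ht => ?_)
    linarith [hαQ z hz t ht]
  refine ⟨f, fun x hx => (hfK x hx).trans_le hα, fun x hx => ?_⟩
  refine nonneg_of_forall_pos_nonneg_add_mul (q := -α) fun t ht => ?_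
  have htα := hαQ x hx t⁻¹ (inv_pos.2 ht)
  rw [inv_mul_eq_div, le_div_iff₀ ht] at htα
  simpa [mul_comm] using htα

variable [Fintype ι]

theorem farkas_on_isOpen {K : Set E} (hKo : IsOpen K) (hKc : Convex ℝ K) (a : ι → E →ₗ[ℝ] ℝ)
    (c : E →ₗ[ℝ] ℝ) {x₀ : E} (hx₀ : x₀ ∈ K) (hax₀ : ∀ i, a i x₀ ≤ 0)
    (h : ∀ x ∈ K, (∀ i, a i x ≤ 0) → c x ≤ 0) :
    ∃ y : ι → ℝ, (∀ i, 0 ≤ y i) ∧ ∀ x ∈ K, c x ≤ ∑ i, y i * a i x := by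
  by_cases hne : (violatingCone a c : Set E).Nonempty
  swap
  · obtain ⟨y, hy, hcy⟩ := farkas a c fun x hx => not_lt.1 fun hcx => hne ⟨x, hx, hcx⟩
    exact ⟨y, hy, fun x _ => (hcy x).le⟩
  have hdisj : Disjoint K (violatingCone a c) :=
    Set.disjoint_left.2 fun x hxK hx => hx.2.not_ge (h x hxK hx.1)
  obtain ⟨f, hfK, hfQ⟩ := exists_neg_on_isOpen_nonneg_on_cone hKo hKc hne hdisj
  obtain ⟨y, hy, hfy⟩ := farkas (fun i : Option ι => i.elim (-c) a) (-f) fun x hx => by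
    have hfx := nonneg_of_nonneg_on_violatingCone hne hfQ (fun i => hx (some i))
      (by simpa using hx none)
    simpa using hfx
  have hyc (x : E) : y none * c x = ∑ i, y (some i) * a i x + f x := by
    have hfyx := hfy x
    simp only [Fintype.sum_option, Option.elim_none, Option.elim_some, LinearMap.neg_apply] at hfyx
    linarith
  have hy₀ : 0 < y none := by
    refine (hy none).lt_of_ne fun hy₀ => ?_
    have hsum : ∑ i, y (some i) * a i x₀ ≤ 0 :=
      Finset.sum_nonpos fun i _ => mul_nonpos_of_nonneg_of_nonpos (hy _) (hax₀ i)
    have hyc₀ := hyc x₀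
    rw [← hy₀] at hyc₀
    linarith [hfK x₀ hx₀]
  refine ⟨fun i => y (some i) / y none, fun i => div_nonneg (hy _) hy₀.le, fun x hx => ?_⟩
  simp only [div_mul_eq_mul_div, ← Finset.sum_div]
  rw [le_div_iff₀' hy₀, hyc]
  linarith [hfK x hx]

/- Homogenize: apply `farkas_on_isOpen` on `K × (0, ∞)` to the constraints `a i x ≤ s * b i`, and
let `s → 0`, respectively `x → 0`. -/
theorem exists_conic_dual_of_isOpen {K : ConvexCone ℝ E} (hK : IsOpen (K : Set E))
    (a : ι → E →ₗ[ℝ] ℝ) (b : ι → ℝ) (c : E →ₗ[ℝ] ℝ) (v : ℝ) {x₀ : E} (hx₀ : x₀ ∈ K)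
    (hax₀ : ∀ i, a i x₀ ≤ b i) (h : ∀ x ∈ K, (∀ i, a i x ≤ b i) → c x ≤ v) :
    ∃ y : ι → ℝ, (∀ i, 0 ≤ y i) ∧ (∀ x ∈ K, c x ≤ ∑ i, y i * a i x) ∧ ∑ i, y i * b i ≤ v := by
  let homogenize (f : E →ₗ[ℝ] ℝ) (r : ℝ) : E × ℝ →ₗ[ℝ] ℝ := f.coprod (-r • LinearMap.id)
  have homogenize_apply (f : E →ₗ[ℝ] ℝ) (r : ℝ) (x : E) (s : ℝ) :
      homogenize f r (x, s) = f x - r * s := by simp [homogenize, sub_eq_add_neg]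
  obtain ⟨y, hy, hyK⟩ := farkas_on_isOpen (hK.prod isOpen_Ioi) (K.convex.prod (convex_Ioi 0))
    (fun i => homogenize (a i) (b i)) (homogenize c v) (x₀ := (x₀, 1))
    ⟨hx₀, Set.mem_Ioi.2 one_pos⟩ (fun i => by simpa [homogenize_apply] using hax₀ i) <| by
    rintro ⟨x, s⟩ ⟨hx, hs : 0 < s⟩ hxs
    have hcx := h (s⁻¹ • x) (K.smul_mem (inv_pos.2 hs) hx) fun i => by
      have hxi := hxs i
      rw [homogenize_apply, sub_nonpos] at hxi
      rwa [map_smul, smul_eq_mul, inv_mul_le_iff₀' hs]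
    rw [map_smul, smul_eq_mul, inv_mul_le_iff₀' hs] at hcx
    rwa [homogenize_apply, sub_nonpos]
  have hgap : ∀ x ∈ K, ∀ s > 0,
      0 ≤ (∑ i, y i * a i x - c x) + s * (v - ∑ i, y i * b i) := fun x hx s hs => by
    have hxs := hyK (x, s) ⟨hx, hs⟩
    simp only [homogenize_apply, mul_sub, Finset.sum_sub_distrib, ← mul_assoc,
      ← Finset.sum_mul] at hxs
    linarith
  refine ⟨y, hy, fun x hx => ?_, ?_⟩
  · exact sub_nonneg.1 (nonneg_of_forall_pos_nonneg_add_mul (hgap x hx))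
  · refine sub_nonneg.1 (nonneg_of_forall_pos_nonneg_add_mul
      (q := ∑ i, y i * a i x₀ - c x₀) fun t ht => ?_)
    have htx₀ := hgap (t • x₀) (K.smul_mem ht hx₀) 1 one_pos
    simp only [map_smul, smul_eq_mul, mul_left_comm _ t, ← Finset.mul_sum] at htx₀
    linarith

end ConicDuality

section IntegralSupport

/- On `S`, where `f ≤ h`, the superlevel sets of `N (f x - h) + g x` decrease with `N`, and for
levels above `M` their intersection is empty. The `min` extends the monotonicity beyond `S`. -/
theorem tendsto_sub_mul_of_isGreatest {X : Type*} [TopologicalSpace X] {S : Set X}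
    (hS : IsCompact S) {f g : X → ℝ} (hf : Continuous f) (hg : Continuous g) {h M : ℝ}
    (hh : IsGreatest (f '' S) h) (hM : IsGreatest (g '' {x ∈ S | f x = h}) M) {v : ℕ → ℝ}
    (hv : ∀ N : ℕ, IsGreatest ((fun x => N * f x + g x) '' S) (v N)) :
    Tendsto (fun N : ℕ => v N - N * h) atTop (𝓝 M) := by
  refine tendsto_order.2 ⟨fun a haM => .of_forall fun N => haM.trans_le ?_, fun a haM => ?_⟩
  · obtain ⟨x, ⟨hxS, hxh⟩, rfl⟩ := hM.1
    have hvx : N * f x + g x ≤ v N := (hv N).2 ⟨x, hxS, rfl⟩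
    rw [hxh] at hvx
    linarith
  have hle (x : X) (hx : x ∈ S) : f x - h ≤ 0 := sub_nonpos.2 (hh.2 ⟨x, hx, rfl⟩)
  let U (N : ℕ) : Set X := {x | N * min (f x - h) 0 + g x < a}
  have hUmono : Monotone U := fun N N' hN x (hx : _ < a) => by
    have hNN' : N' * min (f x - h) 0 ≤ N * min (f x - h) 0 :=
      mul_le_mul_of_nonpos_right (Nat.cast_le.2 hN) (min_le_right _ _)
    exact (add_le_add_left hNN' (g x)).trans_lt hx
  have hcover : S ⊆ ⋃ N, U N := fun x hx => by
    rcases (hle x hx).eq_or_lt with hxh | hxh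
    · have hgx : g x ≤ M := hM.2 ⟨x, ⟨hx, sub_eq_zero.1 hxh⟩, rfl⟩
      exact Set.mem_iUnion.2 ⟨0, by simpa [U] using hgx.trans_lt haM⟩
    · obtain ⟨N, hN⟩ := exists_nat_gt ((g x - a) / (h - f x))
      rw [div_lt_iff₀ (by linarith)] at hN
      refine Set.mem_iUnion.2 ⟨N, ?_⟩
      rw [Set.mem_ofPred_eq, min_eq_left hxh.le]
      linarith
  obtain ⟨N₀, hN₀⟩ := hS.elim_directed_cover U
    (fun N => isOpen_lt (by fun_prop) continuous_const) hcover hUmono.directed_le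
  filter_upwards [eventually_ge_atTop N₀] with N hN
  obtain ⟨x, hx, hxv⟩ := (hv N).1
  have hxU : N * min (f x - h) 0 + g x < a := hUmono hN (hN₀ hx)
  rw [min_eq_left (hle x hx)] at hxU
  change N * f x + g x = v N at hxv
  linarith

theorem isCompact_face {E : Type*} [NormedAddCommGroup E] [InnerProductSpace ℝ E] {S : Set E}
    (hS : IsCompact S) (w : E) (h : ℝ) :
    IsCompact {x ∈ S | inner ℝ w x = h} :=
  hS.inter_right (isClosed_eq (by fun_prop) continuous_const)

variable {d : ℕ} {x y : EuclideanSpace ℝ (Fin d)} {S : Set (EuclideanSpace ℝ (Fin d))}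

theorem IntVec.nsmul_add (hx : IntVec x) (hy : IntVec y) (N : ℕ) :
    IntVec ((N : ℝ) • x + y) := fun i => by
  obtain ⟨p, hp⟩ := hx i
  obtain ⟨q, hq⟩ := hy i
  exact ⟨N * p + q, by simp [hp, hq]⟩

theorem IntVec.single (i : Fin d) : IntVec (EuclideanSpace.single i (1 : ℝ)) := fun j => by
  by_cases hji : j = i
  · exact ⟨1, by simp [hji]⟩
  · exact ⟨0, by simp [hji]⟩

theorem IntVec.exists_inner_eq (hx : IntVec x) (hy : IntVec y) :
    ∃ z : ℤ, inner ℝ x y = (z : ℝ) := by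
  choose p hp using hx
  choose q hq using hy
  exact ⟨∑ i, q i * p i, by simp [PiLp.inner_apply, hp, hq]⟩

theorem IntVec.eq_zero_or_eq_one (hx : IntVec x) {i : Fin d} (hi : x i ∈ Set.Icc (0 : ℝ) 1) :
    x i = 0 ∨ x i = 1 := by
  obtain ⟨z, hz⟩ := hx i
  rw [hz] at hi ⊢
  have hz₀ : 0 ≤ z := by exact_mod_cast hi.1
  have hz₁ : z ≤ 1 := by exact_mod_cast hi.2
  rcases (by lia : z = 0 ∨ z = 1) with rfl | rfl <;> simp

theorem isGreatest_inner_integerHull {w : EuclideanSpace ℝ (Fin d)} (hxS : x ∈ S) (hx : IntVec x)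
    (hmax : IsGreatest ((fun x => inner ℝ w x) '' S) (inner ℝ w x)) :
    IsGreatest ((fun x => inner ℝ w x) '' integerHull S) (inner ℝ w x) := by
  refine ⟨⟨x, subset_convexHull ℝ _ ⟨hxS, hx⟩, rfl⟩, Set.forall_mem_image.2 ?_⟩
  exact convexHull_min (fun y hy => hmax.2 ⟨y, hy.1, rfl⟩)
    (convex_halfSpace_le (innerₗ _ w).isLinear _)

/-- The support function of `S` takes integer values, attained on `S`, at integral vectors. -/
def HasIntegralSupport (S : Set (EuclideanSpace ℝ (Fin d))) : Prop :=
  ∀ u, IntVec u → ∃ z : ℤ, IsGreatest ((fun x => inner ℝ u x) '' S) (z : ℝ)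

theorem HasIntegralSupport.face (hsupp : HasIntegralSupport S) (hS : IsCompact S)
    {w : EuclideanSpace ℝ (Fin d)} (hw : IntVec w) {h : ℤ}
    (hh : IsGreatest ((fun x => inner ℝ w x) '' S) (h : ℝ)) :
    HasIntegralSupport {x ∈ S | inner ℝ w x = (h : ℝ)} := by
  intro u hu
  obtain ⟨M, hM⟩ : ∃ M, IsGreatest ((fun x => inner ℝ u x) '' {x ∈ S | inner ℝ w x = (h : ℝ)}) M :=
    ((isCompact_face hS w h).image (by fun_prop)).exists_isGreatest (.image _ hh.1)
  choose z hz using fun N : ℕ => hsupp _ (hw.nsmul_add hu N)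
  simp only [inner_add_left, real_inner_smul_left] at hz
  have hlim : Tendsto (fun N : ℕ => z N - N * (h : ℝ)) atTop (𝓝 M) :=
    tendsto_sub_mul_of_isGreatest hS (by fun_prop) (by fun_prop) hh hM hz
  obtain ⟨M', rfl⟩ : M ∈ Set.range ((↑) : ℤ → ℝ) :=
    Int.isClosedEmbedding_coe_real.isClosed_range.mem_of_tendsto hlim
      (.of_forall fun N => ⟨z N - N * h, by push_cast; rfl⟩)
  exact ⟨M', hM⟩

theorem HasIntegralSupport.exists_mem_forall_apply_eq_intCast (hsupp : HasIntegralSupport S)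
    (hS : IsCompact S) (s : Finset (Fin d)) : ∃ x ∈ S, ∀ i ∈ s, ∃ z : ℤ, x i = z := by
  induction s using Finset.induction_on generalizing S with
  | empty =>
    obtain ⟨-, ⟨x, hx, -⟩, -⟩ := hsupp 0 fun _ => ⟨0, by simp⟩
    exact ⟨x, hx, by simp⟩
  | insert i s _ ih =>
    obtain ⟨z, hz⟩ := hsupp _ (IntVec.single i)
    obtain ⟨x, ⟨hxS, hxi⟩, hxs⟩ := ih (hsupp.face hS (IntVec.single i) hz) (isCompact_face hS _ _)
    rw [EuclideanSpace.inner_single_left, map_one, one_mul] at hxi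
    exact ⟨x, hxS, (Finset.forall_mem_insert ..).2 ⟨⟨z, hxi⟩, hxs⟩⟩

theorem HasIntegralSupport.exists_intVec_isGreatest (hsupp : HasIntegralSupport S)
    (hS : IsCompact S) {w : EuclideanSpace ℝ (Fin d)} (hw : IntVec w) :
    ∃ x ∈ S, IntVec x ∧ IsGreatest ((fun x => inner ℝ w x) '' S) (inner ℝ w x) := by
  obtain ⟨h, hh⟩ := hsupp w hw
  obtain ⟨x, ⟨hxS, hxh⟩, hx⟩ :=
    (hsupp.face hS hw hh).exists_mem_forall_apply_eq_intCast (isCompact_face hS w h) Finset.univ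
  exact ⟨x, hxS, fun i => hx i (Finset.mem_univ i), hxh ▸ hh⟩

end IntegralSupport

section Semidefinite

variable {W : Type*}

theorem SymMat.isHermitian (X : SymMat W) : X.toMatrix.IsHermitian := by
  have hX : X.toMatrix.transpose = X.toMatrix := X.2
  rwa [Matrix.IsHermitian, Matrix.conjTranspose_eq_transpose_of_trivial]

theorem toMatrix_outer (u : W → ℝ) : (outer u).toMatrix = Matrix.vecMulVec u u := rfl

theorem outer_smul (t : ℝ) (u : W → ℝ) : outer (t • u) = t ^ 2 • outer u := by
  refine Subtype.ext (?_ : Matrix.vecMulVec (t • u) (t • u) = t ^ 2 • Matrix.vecMulVec u u)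
  rw [Matrix.smul_vecMulVec, Matrix.vecMulVec_smul, smul_smul, sq]

theorem posSemidef_outer [Finite W] (u : W → ℝ) : (outer u).toMatrix.PosSemidef := by
  simpa [toMatrix_outer] using Matrix.posSemidef_vecMulVec_self_star u

theorem posSemidef_sum_natCast_smul_outer [Finite W] {ι : Type*} (s : Finset ι) (μ : ι → ℕ)
    (u : ι → W → ℝ) : (∑ i ∈ s, (μ i : ℝ) • outer (u i)).toMatrix.PosSemidef := by
  rw [map_sum]
  refine Matrix.posSemidef_sum _ fun i _ => ?_
  rw [map_smul]
  exact (posSemidef_outer _).smul (Nat.cast_nonneg _)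

/-- The cone of positive definite matrices; it is open, unlike the cone of positive semidefinite
ones. -/
def posDefCone (W : Type*) : ConvexCone ℝ (SymMat W) where
  carrier := {X | X.toMatrix.PosDef}
  smul_mem' t ht X hX := by
    rw [Set.mem_ofPred_eq, map_smul]
    exact Matrix.PosDef.smul hX ht
  add_mem' X hX Y hY := by
    rw [Set.mem_ofPred_eq, map_add]
    exact Matrix.PosDef.add hX hY

theorem mem_posDefCone {X : SymMat W} : X ∈ posDefCone W ↔ X.toMatrix.PosDef := Iff.rfl

variable [Fintype W]

theorem SymMat.inner_outer (X : SymMat W) (u : W → ℝ) :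
    inner ℝ X (outer u) = u ⬝ᵥ X.toMatrix.mulVec u := by
  change (X.toMatrix * (Matrix.vecMulVec u u).transpose).trace = _
  rw [Matrix.transpose_vecMulVec, Matrix.mul_vecMulVec, Matrix.trace_vecMulVec, dotProduct_comm]

theorem SymMat.posSemidef_iff (X : SymMat W) :
    X.toMatrix.PosSemidef ↔ ∀ u : W → ℝ, 0 ≤ inner ℝ X (outer u) := by
  rw [Matrix.posSemidef_iff_dotProduct_mulVec, and_iff_right X.isHermitian]
  simp [SymMat.inner_outer]

theorem SymMat.posDef_iff (X : SymMat W) :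
    X.toMatrix.PosDef ↔ ∀ u : W → ℝ, u ≠ 0 → 0 < inner ℝ X (outer u) := by
  rw [Matrix.posDef_iff_dotProduct_mulVec, and_iff_right X.isHermitian]
  simp [SymMat.inner_outer]

theorem SymMat.inner_nonneg {X Y : SymMat W} (hX : X.toMatrix.PosSemidef)
    (hY : Y.toMatrix.PosSemidef) : 0 ≤ inner ℝ X Y := by
  obtain ⟨r, u, hu⟩ := Matrix.posSemidef_iff_eq_sum_vecMulVec.1 hY
  have hsum : Y = ∑ i, outer (u i) := by
    refine Subtype.ext (?_ : Y.toMatrix = (∑ i, outer (u i)).toMatrix)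
    rw [hu, map_sum]
    simp [toMatrix_outer]
  rw [hsum, inner_sum]
  exact Finset.sum_nonneg fun i _ => X.posSemidef_iff.1 hX (u i)

theorem SymMat.posDef_of_forall_mem_sphere {X : SymMat W}
    (hX : ∀ u ∈ Metric.sphere (0 : W → ℝ) 1, 0 < inner ℝ X (outer u)) : X.toMatrix.PosDef := by
  refine X.posDef_iff.2 fun u hu => ?_
  have hnorm : ‖u‖ ≠ 0 := norm_ne_zero_iff.2 hu
  have hpos := hX (‖u‖⁻¹ • u) (by simp [norm_smul, hnorm])
  rw [outer_smul, real_inner_smul_right] at hpos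
  exact pos_of_mul_pos_right hpos (by positivity)

theorem isOpen_posDefCone : IsOpen (posDefCone W : Set (SymMat W)) := by
  have hcont : Continuous fun p : SymMat W × (W → ℝ) => (inner ℝ p.1 (outer p.2) : ℝ) := by
    have htoMatrix : Continuous (SymMat.toMatrix (W := W)) :=
      LinearMap.continuous_of_finiteDimensional _
    simp only [SymMat.inner_outer]
    fun_prop
  refine isOpen_iff_eventually.2 fun X hX => ?_
  refine ((isCompact_sphere (0 : W → ℝ) 1).eventually_forall_of_forall_eventually
    fun u hu => ?_).mono fun Y => SymMat.posDef_of_forall_mem_sphere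
  have hu₀ : u ≠ 0 := ne_zero_of_mem_unit_sphere ⟨u, hu⟩
  exact hcont.continuousAt.eventually (lt_mem_nhds (X.posDef_iff.1 hX u hu₀))

theorem SymMat.posSemidef_of_forall_posDef_inner_nonneg {S : SymMat W}
    (hS : ∀ X : SymMat W, X.toMatrix.PosDef → 0 ≤ inner ℝ S X) : S.toMatrix.PosSemidef := by
  classical
  let I : SymMat W := ⟨1, Matrix.isSymm_one⟩
  refine S.posSemidef_iff.2 fun u => ?_
  refine nonneg_of_forall_pos_nonneg_add_mul (q := inner ℝ S I) fun t ht => ?_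
  have hpd : (outer u + t • I).toMatrix.PosDef := by
    rw [map_add, map_smul]
    exact .posSemidef_add (posSemidef_outer u) (Matrix.PosDef.one.smul ht)
  simpa [inner_add_right, real_inner_smul_right] using hS _ hpd

end Semidefinite

section Values

variable {E : Type*} [NormedAddCommGroup E] [InnerProductSpace ℝ E] {c : E} {F : Set E} {v : ℝ}

theorem supValue_eq_of_isGreatest (hv : IsGreatest ((fun x => inner ℝ c x) '' F) v) :
    supValue c F = v := by
  have hlub := (EReal.coe_strictMono.monotone.map_isGreatest hv).isLUB.sSup_eq
  rwa [Set.image_image, sSup_image] at hlub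

theorem infValue_eq_of_isLeast (hv : IsLeast ((fun x => inner ℝ c x) '' F) v) :
    infValue c F = v := by
  have hglb := (EReal.coe_strictMono.monotone.map_isLeast hv).isGLB.sInf_eq
  rwa [Set.image_image, sInf_image] at hglb

end Values

theorem image_inner_image_adjoint {E F : Type*} [NormedAddCommGroup E] [InnerProductSpace ℝ E]
    [FiniteDimensional ℝ E] [NormedAddCommGroup F] [InnerProductSpace ℝ F]
    [FiniteDimensional ℝ F] (T : E →ₗ[ℝ] F) (w : E) (S : Set F) :
    (fun x => inner ℝ w x) '' (LinearMap.adjoint T '' S) = (fun x => inner ℝ (T w) x) '' S := by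
  simp only [Set.image_image, LinearMap.adjoint_inner_right]

section Duality

variable {V : Type*} [Fintype V] {m k : ℕ} {A : SymHat V →ₗ[ℝ] EuclideanSpace ℝ (Fin m)}
  {b : EuclideanSpace ℝ (Fin m)} {C : SymHat V} {L : EuclideanSpace ℝ (Fin k) →ₗ[ℝ] SymHat V}
  {v : ℝ}

theorem inner_le_inner_of_feasible {X : SymHat V} (hX : X ∈ sdpFeasible A b)
    {y : EuclideanSpace ℝ (Fin m)} (hy : y ∈ sddFeasible A C) : inner ℝ C X ≤ inner ℝ b y := by
  calc
    inner ℝ C X ≤ inner ℝ (LinearMap.adjoint A y) X := by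
      simpa [inner_sub_left] using SymMat.inner_nonneg hy.2 hX.1
    _ = inner ℝ y (A X) := LinearMap.adjoint_inner_left A X y
    _ = ∑ i, A X i * y i := by simp [PiLp.inner_apply]
    _ ≤ ∑ i, b i * y i :=
      Finset.sum_le_sum fun i _ => mul_le_mul_of_nonneg_right (hX.2 i) (hy.1 i)
    _ = inner ℝ b y := by simp [PiLp.inner_apply, mul_comm]

theorem exists_mem_sddFeasible_inner_le (hpd : ∃ X ∈ sdpFeasible A b, X.toMatrix.PosDef)
    (hv : ∀ X ∈ sdpFeasible A b, inner ℝ C X ≤ v) : ∃ y ∈ sddFeasible A C, inner ℝ b y ≤ v := by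
  obtain ⟨X₀, hX₀, hX₀pd⟩ := hpd
  obtain ⟨y, hy, hyC, hyb⟩ := exists_conic_dual_of_isOpen isOpen_posDefCone
    (fun i => (EuclideanSpace.proj i : EuclideanSpace ℝ (Fin m) →L[ℝ] ℝ).toLinearMap ∘ₗ A)
    (fun i => b i) (innerₗ (SymHat V) C) v hX₀pd hX₀.2
    fun X hX hXb => hv X ⟨(mem_posDefCone.1 hX).posSemidef, hXb⟩
  refine ⟨WithLp.toLp 2 y, ⟨hy, ?_⟩, by simpa [PiLp.inner_apply] using hyb⟩
  refine SymMat.posSemidef_of_forall_posDef_inner_nonneg fun X hX => ?_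
  rw [inner_sub_left, LinearMap.adjoint_inner_left, sub_nonneg]
  simpa [PiLp.inner_apply, mul_comm] using hyC X hX

theorem isLeast_sdd_of_isGreatest_sdp (hpd : ∃ X ∈ sdpFeasible A b, X.toMatrix.PosDef)
    (hv : IsGreatest ((fun X => inner ℝ C X) '' sdpFeasible A b) v) :
    IsLeast ((fun y => inner ℝ b y) '' sddFeasible A C) v := by
  obtain ⟨y, hy, hyv⟩ := exists_mem_sddFeasible_inner_le hpd (Set.forall_mem_image.1 hv.2)
  obtain ⟨X, hX, rfl⟩ := hv.1
  exact ⟨⟨y, hy, hyv.antisymm (inner_le_inner_of_feasible hX hy)⟩,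
    Set.forall_mem_image.2 fun z hz => inner_le_inner_of_feasible hX hz⟩

variable [DecidableEq V]

theorem isdpFeasible_subset_sdpFeasible : isdpFeasible A b ⊆ sdpFeasible A b := by
  rintro X ⟨⟨μ, rfl⟩, hX⟩
  exact ⟨posSemidef_sum_natCast_smul_outer _ _ _, hX⟩

theorem isddFeasible_subset_sddFeasible : isddFeasible A C ⊆ sddFeasible A C := by
  rintro y ⟨-, hy, μ, hμ⟩
  exact ⟨hy, hμ ▸ posSemidef_sum_natCast_smul_outer _ _ _⟩

theorem primalIntegral_embed (U : Finset V) : PrimalIntegral (embed U) :=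
  ⟨Pi.single U 1, by simp [embed, Pi.single_apply]⟩

theorem IsTDIThrough.isLeast_isdd (hTDI : IsTDIThrough A b L) {w : EuclideanSpace ℝ (Fin k)}
    (hw : IntVec w) (hv : IsLeast ((fun y => inner ℝ b y) '' sddFeasible A (L w)) v) :
    IsLeast ((fun y => inner ℝ b y) '' isddFeasible A (L w)) v := by
  obtain ⟨y, hy, rfl⟩ := hv.1
  obtain ⟨z, hzopt, hz⟩ := hTDI w hw ⟨y, hy, Set.forall_mem_image.1 hv.2⟩
  exact ⟨⟨z, hz, (hzopt.2 y hy).antisymm (hv.2 ⟨z, hzopt.1, rfl⟩)⟩,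
    lowerBounds_mono_set (Set.image_mono isddFeasible_subset_sddFeasible) hv.2⟩

theorem IsTDIThrough.hasIntegralSupport (hTDI : IsTDIThrough A b L) (hb : IntVec b)
    (hpd : ∃ X ∈ sdpFeasible A b, X.toMatrix.PosDef)
    (hcpt : IsCompact (LinearMap.adjoint L '' sdpFeasible A b)) :
    HasIntegralSupport (LinearMap.adjoint L '' sdpFeasible A b) := by
  intro u hu
  have hne : (sdpFeasible A b).Nonempty := hpd.imp fun _ => And.left
  obtain ⟨v, hv⟩ : ∃ v, IsGreatest
      ((fun x => inner ℝ u x) '' (LinearMap.adjoint L '' sdpFeasible A b)) v :=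
    (hcpt.image (by fun_prop)).exists_isGreatest ((hne.image _).image _)
  have hsdp := image_inner_image_adjoint L u (sdpFeasible A b) ▸ hv
  obtain ⟨y, hy, rfl⟩ := (hTDI.isLeast_isdd hu (isLeast_sdd_of_isGreatest_sdp hpd hsdp)).1
  obtain ⟨z, hz⟩ := hb.exists_inner_eq hy.1
  exact ⟨z, hz ▸ hv⟩

end Duality

end SemidefTDI

theorem theorem14 {V : Type*} [Fintype V] [DecidableEq V] {m k : ℕ}
    (A : SymHat V →ₗ[ℝ] EuclideanSpace ℝ (Fin m)) (b : EuclideanSpace ℝ (Fin m))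
    (L : EuclideanSpace ℝ (Fin k) →ₗ[ℝ] SymHat V)
    (Chat : Set (SymHat V)) (hChat : Chat = sdpFeasible A b)
    (C : Set (EuclideanSpace ℝ (Fin k))) (hC : C = LinearMap.adjoint L '' Chat)
    (hTDI : IsTDIThrough A b L) (hb : IntVec b)
    (hpd : ∃ X ∈ Chat, X.toMatrix.PosDef)
    (hbox : ∀ x ∈ C, ∀ i, x i ∈ Set.Icc (0 : ℝ) 1) (hcpt : IsCompact C)
    (hemb : IsRankOneEmbedding L Chat C)
    (w : EuclideanSpace ℝ (Fin k)) (hw : IntVec w) :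
    ∃ v : ℝ,
      IsGreatest ((fun x => inner ℝ w x) '' integerHull C) v ∧
      (supValue (L w) (isdpFeasible A b) = v ∧
        supValue (L w) (sdpFeasible A b) = v ∧
        infValue b (sddFeasible A (L w)) = v ∧
        infValue b (isddFeasible A (L w)) = v) ∧
      (∃ X ∈ isdpFeasible A b, inner ℝ (L w) X = v) ∧
      (∃ X ∈ sdpFeasible A b, inner ℝ (L w) X = v) ∧
      (∃ y ∈ sddFeasible A (L w), inner ℝ b y = v) ∧
      (∃ y ∈ isddFeasible A (L w), inner ℝ b y = v) := by
  subst hChat hC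
  obtain ⟨x, hxC, hx, hmax⟩ :=
    (hTDI.hasIntegralSupport hb hpd hcpt).exists_intVec_isGreatest hcpt hw
  obtain ⟨U, hU, hUx⟩ := hemb x hxC fun i => hx.eq_zero_or_eq_one (hbox x hxC i)
  have hUw : inner ℝ (L w) (embed U) = inner ℝ w x := by rw [← hUx, LinearMap.adjoint_inner_right]
  have hsdp : IsGreatest ((fun X => inner ℝ (L w) X) '' sdpFeasible A b) (inner ℝ w x) :=
    image_inner_image_adjoint L w (sdpFeasible A b) ▸ hmax
  have hisdp : IsGreatest ((fun X => inner ℝ (L w) X) '' isdpFeasible A b) (inner ℝ w x) :=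
    ⟨⟨embed U, ⟨primalIntegral_embed U, hU.2⟩, hUw⟩,
      upperBounds_mono_set (Set.image_mono isdpFeasible_subset_sdpFeasible) hsdp.2⟩
  have hsdd := isLeast_sdd_of_isGreatest_sdp hpd hsdp
  have hisdd := hTDI.isLeast_isdd hw hsdd
  exact ⟨inner ℝ w x, isGreatest_inner_integerHull hxC hx hmax,
    ⟨supValue_eq_of_isGreatest hisdp, supValue_eq_of_isGreatest hsdp,
      infValue_eq_of_isLeast hsdd, infValue_eq_of_isLeast hisdd⟩,
    hisdp.1, hsdp.1, hsdd.1, hisdd.1⟩
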